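/- Consider $N$ sporadic tasks $\tau_1,\dots,\tau_N$, where $\tau_i$ has worst-case execution time $C_i>0$, relative deadline $D_i>0$ and minimum inter-arrival time $T_i>0$, with $C_i\le D_i$ and utilization $U_i=C_i/T_i\le 1$ (no relation between $D_i$ and $T_i$ is assumed). Each $\tau_i$ releases a sequence of jobs whose consecutive arrivals are at least $T_i$ apart; each job of $\tau_i$ needs at most $C_i$ units of execution and has its absolute deadline $D_i$ time units after its arrival. The jobs are executed on $M\ge 2$ identical unit-speed processors under preemptive global fixed-priority scheduling, where $\tau_i$ has higher priority than $\tau_j$ if $i<j$: at every instant the $M$ highest-priority tasks with unfinished jobs (all such tasks, if there are at most $M$) are executed; at any instant a task executes at most one job, on at most one processor; and the jobs of a task are executed in order of arrival. Let $1\le k\le N$, let $\delta_k=C_k/\min\{D_k,T_k\}$ and $$U^{\max}_{\delta,k}=\max\Big\{\max_{1\le i<k}U_i,\ \delta_k\Big\}$$ (which is $\delta_k$ if $k=1$). Suppose that for every integer $\ell\ge 1$, with $D_k'=(\ell-1)T_k+D_k$, $$\frac{\ell C_k}{D_k'}+\sum_{i=1}^{k-1}\left(\frac{C_i-C_iU_i}{D_k'}+U_i\right)\le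 M-(M-1)\,U^{\max}_{\delta,k}.$$ Then $\tau_k$ is schedulable: for every legal sequence of jobs of the tasks and every resulting schedule, every job of $\tau_k$ finishes no later than its absolute deadline. -/

import Mathlib

open MeasureTheory

namespace GlobalFP

/-- A sporadic real-time task: worst-case execution time `C`, relative deadline `D`,
minimum inter-arrival time (period) `T`. -/
structure Task where
  C : ℝ
  D : ℝ
  T : ℝ

namespace Task

/-- Utilization. -/
noncomputable def U (τ : Task) : ℝ := τ.C / τ.T

/-- Density. -/
noncomputable def density (τ : Task) : ℝ := τ.C / min τ.D τ.T

/-- The standing assumptions on a single (arbitrary-deadline) task: positive parameters,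
`C / D ≤ 1` and utilization at most one. No relation between `D` and `T` is imposed. -/
structure Admissible (τ : Task) : Prop where
  C_pos : 0 < τ.C
  D_pos : 0 < τ.D
  T_pos : 0 < τ.T
  C_div_D_le_one : τ.C / τ.D ≤ 1
  U_le_one : τ.U ≤ 1

end Task

/-- The maximum of the utilizations of the tasks of higher priority than task `k`
and of the density of task `k`: `max (max_{i < k} U_i) δ_k`. -/
noncomputable def Umax {N : ℕ} (τ : Fin N → Task) (k : Fin N) : ℝ :=
  (Finset.Iio k).fold max (τ k).density (fun i => (τ i).U)

/-- A legal behaviour of the task set: the `j`-th job of task `i` arrives at `arrival i j` and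
needs `exec i j ≤ C_i` units of execution; consecutive arrivals of task `i` are at least `T_i`
apart. -/
structure JobSequence {N : ℕ} (τ : Fin N → Task) where
  arrival : Fin N → ℕ → ℝ
  exec : Fin N → ℕ → ℝ
  arrival_add_period_le : ∀ i j, arrival i j + (τ i).T ≤ arrival i (j + 1)
  exec_nonneg : ∀ i j, 0 ≤ exec i j
  exec_le : ∀ i j, exec i j ≤ (τ i).C

/-- An assignment of `M` identical unit-speed processors over time: `S p t = some (i, j)` means
that processor `p` executes the `j`-th job of task `i` at time `t`, and `S p t = none` that it
idles. -/
abbrev Assignment (M N : ℕ) := Fin M → ℝ → Option (Fin N × ℕ)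

/-- The instants at which the `j`-th job of task `i` is executed on some processor. -/
def executionSet {M N : ℕ} (S : Assignment M N) (i : Fin N) (j : ℕ) : Set ℝ :=
  {t | ∃ p, S p t = some (i, j)}

section

variable {M N : ℕ} {τ : Fin N → Task}

/-- The amount of execution that the `j`-th job of task `i` receives from its arrival until
time `t`. -/
noncomputable def service (ω : JobSequence τ) (S : Assignment M N)
    (i : Fin N) (j : ℕ) (t : ℝ) : ℝ :=
  volume.real (executionSet S i j ∩ Set.Ico (ω.arrival i j) t)

/-- The `j`-th job of task `i` has arrived before or at `t` and has not finished at `t`. -/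
def Pending (ω : JobSequence τ) (S : Assignment M N) (i : Fin N) (j : ℕ) (t : ℝ) : Prop :=
  ω.arrival i j ≤ t ∧ service ω S i j t < ω.exec i j

/-- Task `i` is active at `t`: it has a pending job. -/
def Active (ω : JobSequence τ) (S : Assignment M N) (i : Fin N) (t : ℝ) : Prop :=
  ∃ j, Pending ω S i j t

/-- `S` is a schedule of the jobs `ω` under preemptive global fixed-priority scheduling, where
task `i` has higher priority than task `i'` if `i < i'`. -/
structure IsGlobalFPSchedule (ω : JobSequence τ) (S : Assignment M N) : Prop where
  measurableSet_executionSet : ∀ i j, MeasurableSet (executionSet S i j)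
  /-- Only pending jobs are executed. -/
  pending : ∀ p t i j, S p t = some (i, j) → Pending ω S i j t
  /-- The jobs of one task are executed in the order of their arrival. -/
  fifo : ∀ p t i j, S p t = some (i, j) → ∀ j' < j, ¬ Pending ω S i j' t
  /-- No intra-task parallelism: at any instant a task occupies at most one processor. -/
  sequential : ∀ p q t i j j', S p t = some (i, j) → S q t = some (i, j') → p = q
  /-- Work-conserving with priorities: an active task that is not being executed is blocked, that
  is, every processor is executing a job of a task of higher priority. -/
  priority : ∀ i t, Active ω S i t → (∀ p j, S p t ≠ some (i, j)) →
    ∀ p, ∃ i' < i, ∃ j', S p t = some (i', j')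

end

/-- Task `k` is schedulable on `M` processors under global fixed-priority scheduling: for every
legal job sequence and every resulting schedule, each job of task `k` is completed by its absolute
deadline, i.e. its response time is at most `D_k`. -/
def Schedulable {N : ℕ} (M : ℕ) (τ : Fin N → Task) (k : Fin N) : Prop :=
  ∀ (ω : JobSequence τ) (S : Assignment M N), IsGlobalFPSchedule ω S →
    ∀ j, ω.exec k j ≤ service ω S k j (ω.arrival k j + (τ k).D)

end GlobalFP

/-! Suppose that a job of `τ k` misses its deadline `d`, and let `[a, d)` be the maximal interval
before `d` in which `τ k` is active. For some `ℓ ≥ 1` it has length at least `(ℓ - 1) T_k + D_k`,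
and `τ k` is executed in it for less than `ℓ C_k ≤ U^max (d - a)` units of time. Whenever `τ k` is
active but not executed, all `M` processors work for tasks of higher priority, so these tasks do
more than `μ (d - a) - ℓ C_k` units of work in `[a, d)`, where `μ = M - (M - 1) U^max`.

Among `a` and the arrivals before `a` of jobs of higher-priority tasks, let `t` be the earliest
instant at which the work of these tasks in `[t, d)` in excess of the rate `μ` is largest. If `τ i`
with `i < k` has unfinished jobs at `t` and has been active since `b < t`, then by maximality the
higher-priority work in `[b, t)` has rate below `μ`, and this forces `τ i` itself to be executed
there at a rate above `U^max ≥ U_i`. Its carry-in is thereby paid for, and the bound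
`U_i L + C_i - C_i U_i`, valid for intervals of length `L` without carry-in, also holds for
`[t, d)`. Summing these bounds contradicts the test for `ℓ`. -/

namespace GlobalFP

/-- The time that the set `A` occupies in `[s, t)`. -/
noncomputable def occupancy (A : Set ℝ) (s t : ℝ) : ℝ := volume.real (A ∩ Set.Ico s t)

lemma occupancy_eq_measureReal_restrict (A : Set ℝ) (s t : ℝ) :
    occupancy A s t = (volume.restrict (Set.Ico s t)).real A :=
  (measureReal_restrict_apply' measurableSet_Ico).symm

lemma occupancy_nonneg (A : Set ℝ) (s t : ℝ) : 0 ≤ occupancy A s t := measureReal_nonneg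

lemma occupancy_of_le (A : Set ℝ) {s t : ℝ} (h : t ≤ s) : occupancy A s t = 0 := by
  simp [occupancy, Set.Ico_eq_empty_of_le h]

lemma volume_inter_Ico_ne_top (A : Set ℝ) (s t : ℝ) : volume (A ∩ Set.Ico s t) ≠ ⊤ :=
  measure_ne_top_of_subset Set.inter_subset_right (by simp)

lemma occupancy_mono_right (A : Set ℝ) (s : ℝ) : Monotone (occupancy A s) := fun _ _ h =>
  measureReal_mono (Set.inter_subset_inter_right _ (Set.Ico_subset_Ico_right h))
    (volume_inter_Ico_ne_top A s _)

lemma occupancy_le_sub (A : Set ℝ) {s t : ℝ} (h : s ≤ t) : occupancy A s t ≤ t - s :=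
  (measureReal_mono Set.inter_subset_right (by simp)).trans_eq (Real.volume_real_Ico_of_le h)

lemma occupancy_add (A : Set ℝ) {s t u : ℝ} (hst : s ≤ t) (htu : t ≤ u) :
    occupancy A s t + occupancy A t u = occupancy A s u := by
  have hdisj : Disjoint (Set.Ico s t) (Set.Ico t u) := by simp
  simp only [occupancy_eq_measureReal_restrict]
  rw [← Set.Ico_union_Ico_eq_Ico hst htu, Measure.restrict_union hdisj measurableSet_Ico,
    measureReal_add_apply]

lemma occupancy_le_add_dist (A : Set ℝ) (s t u : ℝ) :
    occupancy A s u ≤ occupancy A s t + dist u t := by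
  rcases le_total u t with hut | htu
  · exact (occupancy_mono_right A s hut).trans (le_add_of_nonneg_right dist_nonneg)
  rw [Real.dist_eq, abs_of_nonneg (sub_nonneg.2 htu)]
  rcases le_total s t with hst | hts
  · rw [← occupancy_add A hst htu]
    gcongr
    exact occupancy_le_sub A htu
  · rw [occupancy_of_le A hts, zero_add]
    rcases le_total s u with hsu | hus
    · exact (occupancy_le_sub A hsu).trans (by gcongr)
    · exact (occupancy_of_le A hus).trans_le (sub_nonneg.2 htu)

lemma continuous_occupancy (A : Set ℝ) (s : ℝ) : Continuous (occupancy A s) :=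
  (LipschitzWith.of_le_add fun u t => occupancy_le_add_dist A s t u).continuous

lemma occupancy_eq_setIntegral_indicator {A : Set ℝ} (hA : MeasurableSet A) (s t : ℝ) :
    occupancy A s t = ∫ x in Set.Ico s t, A.indicator 1 x := by
  rw [integral_indicator_one hA, occupancy_eq_measureReal_restrict]

namespace Task

/-- The linear bound on the work that `τ` can do in an interval of length `L` in which only jobs
that arrive within the interval are executed. -/
noncomputable def linearBound (τ : Task) (L : ℝ) : ℝ := τ.U * L + (τ.C - τ.C * τ.U)

variable {τ : Task}

lemma U_nonneg (hC : 0 ≤ τ.C) (hT : 0 < τ.T) : 0 ≤ τ.U := div_nonneg hC hT.le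

lemma U_mul_T (hT : 0 < τ.T) : τ.U * τ.T = τ.C := div_mul_cancel₀ _ hT.ne'

lemma C_sub_C_mul_U_nonneg (hC : 0 ≤ τ.C) (hU : τ.U ≤ 1) : 0 ≤ τ.C - τ.C * τ.U :=
  sub_nonneg.2 (mul_le_of_le_one_right hC hU)

lemma linearBound_nonneg (hC : 0 ≤ τ.C) (hT : 0 < τ.T) (hU : τ.U ≤ 1) {L : ℝ} (hL : 0 ≤ L) :
    0 ≤ τ.linearBound L :=
  add_nonneg (mul_nonneg (U_nonneg hC hT) hL) (C_sub_C_mul_U_nonneg hC hU)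

lemma linearBound_mono (hC : 0 ≤ τ.C) (hT : 0 < τ.T) : Monotone τ.linearBound := fun _ _ h =>
  add_le_add_left (mul_le_mul_of_nonneg_left h (U_nonneg hC hT)) _

lemma density_nonneg (hC : 0 ≤ τ.C) (hD : 0 < τ.D) (hT : 0 < τ.T) : 0 ≤ τ.density :=
  div_nonneg hC (lt_min hD hT).le

lemma mul_C_le_density_mul (hC : 0 ≤ τ.C) (hD : 0 < τ.D) (hT : 0 < τ.T) {ℓ : ℝ} (hℓ : 1 ≤ ℓ) :
    ℓ * τ.C ≤ τ.density * ((ℓ - 1) * τ.T + τ.D) :=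
  calc ℓ * τ.C = ℓ * (τ.density * min τ.D τ.T) := by
        rw [density, div_mul_cancel₀ _ (lt_min hD hT).ne']
    _ = τ.density * ((ℓ - 1) * min τ.D τ.T + min τ.D τ.T) := by ring
    _ ≤ τ.density * ((ℓ - 1) * τ.T + τ.D) := by
        have := density_nonneg hC hD hT
        have := sub_nonneg.2 hℓ
        gcongr
        exacts [min_le_right _ _, min_le_left _ _]

end Task

section

variable {M N : ℕ} {τ : Fin N → Task}

lemma U_le_Umax {i k : Fin N} (h : i < k) : (τ i).U ≤ Umax τ k :=
  (Finset.le_fold_max _).2 (Or.inr ⟨i, Finset.mem_Iio.2 h, le_rfl⟩)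

lemma density_le_Umax (τ : Fin N → Task) (k : Fin N) : (τ k).density ≤ Umax τ k :=
  (Finset.le_fold_max _).2 (Or.inl le_rfl)

lemma add_sum_linearBound_le_mul {s : Finset (Fin N)} {c D μ L : ℝ} (hD : 0 < D) (hDL : D ≤ L)
    (hc : 0 ≤ c) (hs : ∀ i ∈ s, 0 ≤ (τ i).C - (τ i).C * (τ i).U)
    (htest : c / D + ∑ i ∈ s, (((τ i).C - (τ i).C * (τ i).U) / D + (τ i).U) ≤ μ) :
    c + ∑ i ∈ s, (τ i).linearBound L ≤ μ * L := by
  have hL : 0 ≤ L := hD.le.trans hDL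
  have le_div_mul {x : ℝ} (hx : 0 ≤ x) : x ≤ x / D * L := by
    rw [div_mul_eq_mul_div, le_div_iff₀ hD]
    gcongr
  calc c + ∑ i ∈ s, (τ i).linearBound L
      ≤ c / D * L + ∑ i ∈ s, (((τ i).C - (τ i).C * (τ i).U) / D + (τ i).U) * L := by
        gcongr with i hi
        · exact le_div_mul hc
        · rw [Task.linearBound, add_mul, add_comm]
          gcongr
          exact le_div_mul (hs i hi)
    _ = (c / D + ∑ i ∈ s, (((τ i).C - (τ i).C * (τ i).U) / D + (τ i).U)) * L := by
        rw [← Finset.sum_mul, ← add_mul]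
    _ ≤ μ * L := by gcongr

namespace JobSequence

lemma C_nonneg (ω : JobSequence τ) (i : Fin N) : 0 ≤ (τ i).C :=
  (ω.exec_nonneg i 0).trans (ω.exec_le i 0)

variable (ω : JobSequence τ) {i : Fin N}

lemma sub_mul_period_le (i : Fin N) {m n : ℕ} (hmn : m ≤ n) :
    ((n : ℝ) - m) * (τ i).T ≤ ω.arrival i n - ω.arrival i m := by
  induction n, hmn using Nat.le_induction with
  | base => simp
  | succ n _ ih =>
    push_cast
    linarith [ω.arrival_add_period_le i n]

lemma arrival_strictMono (hT : 0 < (τ i).T) : StrictMono (ω.arrival i) :=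
  strictMono_nat_of_lt_succ fun j => by linarith [ω.arrival_add_period_le i j]

lemma tendsto_arrival_atTop (hT : 0 < (τ i).T) :
    Filter.Tendsto (ω.arrival i) Filter.atTop Filter.atTop := by
  refine Filter.tendsto_atTop_mono (fun n => ?_) (Filter.tendsto_atTop_add_const_left _
    (ω.arrival i 0) (tendsto_natCast_atTop_atTop.atTop_mul_const hT))
  simpa [le_sub_iff_add_le'] using ω.sub_mul_period_le i (Nat.zero_le n)

lemma finite_setOf_arrival_le (hT : 0 < (τ i).T) (t : ℝ) : {j | ω.arrival i j ≤ t}.Finite := by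
  simpa [← Nat.cofinite_eq_atTop, Filter.eventually_cofinite] using
    (ω.tendsto_arrival_atTop hT).eventually_gt_atTop t

lemma finite_arrivals_le {s : Set (Fin N)} (hT : ∀ i ∈ s, 0 < (τ i).T) (t : ℝ) :
    {x | x ≤ t ∧ ∃ i ∈ s, ∃ j, ω.arrival i j = x}.Finite := by
  refine (s.toFinite.biUnion fun i hi =>
    (ω.finite_setOf_arrival_le (hT i hi) t).image (ω.arrival i)).subset ?_
  rintro _ ⟨hx, i, hi, j, rfl⟩
  exact Set.mem_biUnion hi ⟨j, hx, rfl⟩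

end JobSequence

/-- The instants at which some job of task `i` is executed. -/
def taskExecutionSet (S : Assignment M N) (i : Fin N) : Set ℝ := ⋃ j, executionSet S i j

/-- The work done for task `i` in `[s, t)`. -/
noncomputable def taskWork (S : Assignment M N) (i : Fin N) (s t : ℝ) : ℝ :=
  occupancy (taskExecutionSet S i) s t

/-- The work done in `[s, t)` for the tasks of higher priority than task `k`. -/
noncomputable def higherPriorityWork (S : Assignment M N) (k : Fin N) (s t : ℝ) : ℝ :=
  ∑ i ∈ Finset.Iio k, taskWork S i s t

/-- The work of the tasks of higher priority than task `k` in `[s, t)` in excess of the rate `μ`;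
negative if the average rate is below `μ`. -/
noncomputable def excessWork (S : Assignment M N) (k : Fin N) (μ s t : ℝ) : ℝ :=
  higherPriorityWork S k s t - μ * (t - s)

/-- All jobs of task `i` that arrived before `b` are finished at `b`. -/
def NoCarryIn (ω : JobSequence τ) (S : Assignment M N) (i : Fin N) (b : ℝ) : Prop :=
  ∀ j, ω.arrival i j < b → ω.exec i j ≤ service ω S i j b

lemma mem_taskExecutionSet {S : Assignment M N} {i : Fin N} {t : ℝ} :
    t ∈ taskExecutionSet S i ↔ ∃ p j, S p t = some (i, j) := by
  simp only [taskExecutionSet, executionSet, Set.mem_iUnion, Set.mem_ofPred_eq]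
  exact exists_comm

lemma taskWork_add (S : Assignment M N) (i : Fin N) {s t u : ℝ} (hst : s ≤ t) (htu : t ≤ u) :
    taskWork S i s t + taskWork S i t u = taskWork S i s u :=
  occupancy_add _ hst htu

lemma excessWork_add (S : Assignment M N) (k : Fin N) (μ : ℝ) {s t u : ℝ} (hst : s ≤ t)
    (htu : t ≤ u) : excessWork S k μ s t + excessWork S k μ t u = excessWork S k μ s u := by
  simp only [excessWork, higherPriorityWork, ← taskWork_add S _ hst htu, Finset.sum_add_distrib]
  ring

lemma taskWork_add_higherPriorityWork_le (S : Assignment M N) {i k : Fin N} (hik : i < k)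
    (s t : ℝ) :
    taskWork S i s t + higherPriorityWork S i s t ≤ higherPriorityWork S k s t := by
  have hsub : Finset.Iic i ⊆ Finset.Iio k := fun x hx =>
    Finset.mem_Iio.2 ((Finset.mem_Iic.1 hx).trans_lt hik)
  calc taskWork S i s t + higherPriorityWork S i s t = ∑ i' ∈ Finset.Iic i, taskWork S i' s t := by
        rw [higherPriorityWork, ← Finset.Iio_insert, Finset.sum_insert Finset.notMem_Iio_self]
    _ ≤ higherPriorityWork S k s t :=
        Finset.sum_le_sum_of_subset_of_nonneg hsub fun _ _ _ => occupancy_nonneg _ _ _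

lemma service_mono (ω : JobSequence τ) (S : Assignment M N) (i : Fin N) (j : ℕ) :
    Monotone (service ω S i j) := occupancy_mono_right _ _

lemma exists_busy_start (ω : JobSequence τ) (S : Assignment M N) {i : Fin N}
    (hT : 0 < (τ i).T) (t : ℝ) :
    ∃ b ≤ t, (∀ x ∈ Set.Ico b t, Active ω S i x) ∧ NoCarryIn ω S i b ∧
      (b = t ∨ ∃ j, ω.arrival i j = b) := by
  classical
  have active_Ico {j : ℕ} {s : ℝ} (hj : service ω S i j s < ω.exec i j) :
      ∀ x ∈ Set.Ico (ω.arrival i j) s, Active ω S i x := fun x hx =>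
    ⟨j, hx.1, (service_mono ω S i j hx.2.le).trans_lt hj⟩
  by_cases hex : ∃ m, ω.arrival i m < t ∧ ∀ x ∈ Set.Ico (ω.arrival i m) t, Active ω S i x
  · obtain ⟨hlt, hact⟩ := Nat.find_spec hex
    refine ⟨_, hlt.le, hact, fun j hj => ?_, Or.inr ⟨_, rfl⟩⟩
    by_contra! hpend
    have hjm : j < Nat.find hex := (ω.arrival_strictMono hT).lt_iff_lt.1 hj
    refine Nat.find_min hex hjm ⟨hj.trans hlt, fun x hx => ?_⟩
    rcases lt_or_ge x (ω.arrival i (Nat.find hex)) with hxm | hxm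
    · exact active_Ico hpend x ⟨hx.1, hxm⟩
    · exact hact x ⟨hxm, hx.2⟩
  · refine ⟨t, le_rfl, by simp, fun j hj => ?_, Or.inl rfl⟩
    by_contra! hpend
    exact hex ⟨j, hj, active_Ico hpend⟩

lemma exists_window_max_excessWork (ω : JobSequence τ) (S : Assignment M N) {k : Fin N}
    (hT : ∀ i < k, 0 < (τ i).T) (μ : ℝ) {a d : ℝ} (had : a ≤ d) :
    ∃ t ≤ a, excessWork S k μ a d ≤ excessWork S k μ t d ∧
      ∀ i < k, ∃ b ≤ t, NoCarryIn ω S i b ∧ (∀ x ∈ Set.Ico b t, Active ω S i x) ∧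
        (b < t → excessWork S k μ b t < 0) := by
  set P : Set ℝ := insert a {x | x ≤ a ∧ ∃ i ∈ Set.Iio k, ∃ j, ω.arrival i j = x}
  -- The leftmost maximizer: the strict inequality `excessWork S k μ b t < 0` is needed for `M = 1`.
  obtain ⟨t, ht, hmax⟩ := Set.exists_max_image P (fun x => toLex (excessWork S k μ x d, -x))
    ((ω.finite_arrivals_le hT a).insert a) ⟨a, Set.mem_insert _ _⟩
  have hlt (x) (hx : x ∈ P) (hxt : x < t) : excessWork S k μ x d < excessWork S k μ t d :=
    (Prod.Lex.le_iff.1 (hmax x hx)).resolve_right fun hle => hxt.not_ge (neg_le_neg_iff.1 hle.2)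
  have hta : t ≤ a := by
    rcases ht with rfl | ht
    exacts [le_rfl, ht.1]
  refine ⟨t, hta, ?_, fun i hik => ?_⟩
  · exact Prod.Lex.monotone_fst _ _ (hmax a (Set.mem_insert _ _))
  · obtain ⟨b, hbt, hact, hcarry, hb⟩ := exists_busy_start ω S (hT i hik) t
    refine ⟨b, hbt, hcarry, hact, fun hlt' => ?_⟩
    have hbP : b ∈ P := Or.inr ⟨hbt.trans hta, i, hik, hb.resolve_left hlt'.ne⟩
    linarith [hlt b hbP hlt', excessWork_add S k μ hbt (hta.trans had)]

namespace IsGlobalFPSchedule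

variable {ω : JobSequence τ} {S : Assignment M N} {i k : Fin N}

lemma pending_of_mem (h : IsGlobalFPSchedule ω S) {j : ℕ} {x : ℝ} (hx : x ∈ executionSet S i j) :
    Pending ω S i j x := by
  obtain ⟨p, hp⟩ := hx
  exact h.pending p x i j hp

lemma not_pending_of_mem (h : IsGlobalFPSchedule ω S) {j j' : ℕ} {x : ℝ}
    (hx : x ∈ executionSet S i j) (hj : j' < j) : ¬ Pending ω S i j' x := by
  obtain ⟨p, hp⟩ := hx
  exact h.fifo p x i j hp j' hj

lemma measurableSet_taskExecutionSet (h : IsGlobalFPSchedule ω S) (i : Fin N) :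
    MeasurableSet (taskExecutionSet S i) :=
  MeasurableSet.iUnion fun j => h.measurableSet_executionSet i j

lemma service_le_exec (h : IsGlobalFPSchedule ω S) (i : Fin N) (j : ℕ) (t : ℝ) :
    service ω S i j t ≤ ω.exec i j := by
  rcases le_total t (ω.arrival i j) with hta | hat
  · exact (occupancy_of_le _ hta).trans_le (ω.exec_nonneg i j)
  by_contra! hlt
  obtain ⟨s, ⟨has, hst⟩, hs⟩ : ω.exec i j ∈ service ω S i j '' Set.Icc (ω.arrival i j) t :=
    intermediate_value_Icc hat (continuous_occupancy _ _).continuousOn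
      ⟨(occupancy_of_le _ le_rfl).trans_le (ω.exec_nonneg i j), hlt.le⟩
  have hidle : executionSet S i j ∩ Set.Ico s t = ∅ := by
    refine Set.eq_empty_of_forall_notMem fun x ⟨hx, hsx, _⟩ => ?_
    exact (h.pending_of_mem hx).2.not_ge (hs.ge.trans (service_mono ω S i j hsx))
  refine hlt.ne' ?_
  calc service ω S i j t = service ω S i j s + occupancy (executionSet S i j) s t :=
        (occupancy_add _ has hst).symm
    _ = ω.exec i j := by simp [occupancy, hidle, hs]

open Classical in
lemma card_le_card_executed (h : IsGlobalFPSchedule ω S) {t : ℝ} (ha : Active ω S i t)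
    (ht : t ∉ taskExecutionSet S i) :
    M ≤ ({i' ∈ Finset.Iio i | t ∈ taskExecutionSet S i'} : Finset (Fin N)).card := by
  choose f hf g hg using h.priority i t ha fun p j hpj => ht (mem_taskExecutionSet.2 ⟨p, j, hpj⟩)
  have hinj : Function.Injective f := fun p q hpq =>
    h.sequential p q t (f p) (g p) (g q) (hg p) (hpq ▸ hg q)
  simpa using Finset.card_le_card_of_injOn (s := Finset.univ) f
    (fun p _ => Finset.mem_filter.2
      ⟨Finset.mem_Iio.2 (hf p), mem_taskExecutionSet.2 ⟨p, g p, hg p⟩⟩) hinj.injOn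

lemma mul_one_sub_indicator_le (h : IsGlobalFPSchedule ω S) {t : ℝ} (ha : Active ω S i t) :
    M * (1 - (taskExecutionSet S i).indicator (1 : ℝ → ℝ) t)
      ≤ ∑ i' ∈ Finset.Iio i, (taskExecutionSet S i').indicator (1 : ℝ → ℝ) t := by
  classical
  by_cases ht : t ∈ taskExecutionSet S i
  · rw [Set.indicator_of_mem ht, Pi.one_apply, sub_self, mul_zero]
    exact Finset.sum_nonneg fun _ _ => Set.indicator_nonneg (fun _ _ => zero_le_one) _
  · simpa [Set.indicator_apply, ht] using h.card_le_card_executed ha ht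

lemma mul_sub_taskWork_le (h : IsGlobalFPSchedule ω S) {s t : ℝ} (hst : s ≤ t)
    (ha : ∀ x ∈ Set.Ico s t, Active ω S i x) :
    M * ((t - s) - taskWork S i s t) ≤ higherPriorityWork S i s t := by
  have hwork (i') : taskWork S i' s t =
      ∫ x in Set.Ico s t, (taskExecutionSet S i').indicator (1 : ℝ → ℝ) x :=
    occupancy_eq_setIntegral_indicator (h.measurableSet_taskExecutionSet i') s t
  have hint (i') : IntegrableOn ((taskExecutionSet S i').indicator (1 : ℝ → ℝ)) (Set.Ico s t) :=
    (integrableOn_const (by simp)).indicator (h.measurableSet_taskExecutionSet i')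
  have hone : IntegrableOn (fun _ => (1 : ℝ)) (Set.Ico s t) := integrableOn_const (by simp)
  have hlen : t - s = ∫ _ in Set.Ico s t, (1 : ℝ) := by
    simp [Real.volume_real_Ico_of_le hst]
  simp only [higherPriorityWork, hwork]
  rw [← integral_finsetSum _ fun i' _ => hint i', hlen, ← integral_sub hone (hint i),
    ← integral_const_mul]
  exact setIntegral_mono_on ((hone.sub (hint i)).const_mul _)
    (integrable_finsetSum _ fun i' _ => hint i') measurableSet_Ico
    fun x hx => h.mul_one_sub_indicator_le (ha x hx)

lemma le_arrival_of_noCarryIn (h : IsGlobalFPSchedule ω S) {b x : ℝ} (hb : NoCarryIn ω S i b)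
    (hbx : b ≤ x) {j : ℕ} (hx : x ∈ executionSet S i j) : b ≤ ω.arrival i j := by
  by_contra! hlt
  exact (h.pending_of_mem hx).2.not_ge ((hb j hlt).trans (service_mono ω S i j hbx))

lemma taskWork_le_sum_service (h : IsGlobalFPSchedule ω S) {b d : ℝ} {J : Finset ℕ}
    (hJ : ∀ j, ∀ x ∈ Set.Ico b d, x ∈ executionSet S i j → j ∈ J) :
    taskWork S i b d ≤ ∑ j ∈ J, service ω S i j d := by
  have hsub : taskExecutionSet S i ∩ Set.Ico b d ⊆
      ⋃ j ∈ J, executionSet S i j ∩ Set.Ico (ω.arrival i j) d := by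
    rintro x ⟨hx, hxI⟩
    obtain ⟨j, hj⟩ := Set.mem_iUnion.1 hx
    exact Set.mem_biUnion (hJ j x hxI hj) ⟨hj, (h.pending_of_mem hj).1, hxI.2⟩
  have hfin : volume (⋃ j ∈ J, executionSet S i j ∩ Set.Ico (ω.arrival i j) d) ≠ ⊤ :=
    (measure_biUnion_lt_top J.finite_toSet fun j _ => (volume_inter_Ico_ne_top _ _ _).lt_top).ne
  exact (measureReal_mono hsub hfin).trans (measureReal_biUnion_finset_le _ _)

lemma sum_Icc_service_le_linearBound (h : IsGlobalFPSchedule ω S) (hT : 0 < (τ i).T)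
    (hU : (τ i).U ≤ 1) {m n : ℕ} (hmn : m ≤ n) {d : ℝ} (hd : ω.arrival i n ≤ d) :
    ∑ j ∈ Finset.Icc m n, service ω S i j d ≤ (τ i).linearBound (d - ω.arrival i m) := by
  have hU0 : 0 ≤ (τ i).U := Task.U_nonneg (ω.C_nonneg i) hT
  have hs (j) : service ω S i j d ≤ (τ i).C := (h.service_le_exec i j d).trans (ω.exec_le i j)
  have hearly : ∑ j ∈ Finset.Ico m n, service ω S i j d
      ≤ (τ i).U * (ω.arrival i n - ω.arrival i m) :=
    calc ∑ j ∈ Finset.Ico m n, service ω S i j d ≤ ((n : ℝ) - m) * (τ i).C := by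
          simpa [Nat.cast_sub hmn] using
            Finset.sum_le_card_nsmul (Finset.Ico m n) _ _ fun j _ => hs j
      _ = (τ i).U * (((n : ℝ) - m) * (τ i).T) := by rw [← Task.U_mul_T hT]; ring
      _ ≤ (τ i).U * (ω.arrival i n - ω.arrival i m) := by
          gcongr
          exact ω.sub_mul_period_le i hmn
  have hlast : service ω S i n d ≤ (τ i).U * (d - ω.arrival i n) + (1 - (τ i).U) * (τ i).C :=
    calc service ω S i n d
        = (τ i).U * service ω S i n d + (1 - (τ i).U) * service ω S i n d := by ring
      _ ≤ _ := by
          have := sub_nonneg.2 hU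
          gcongr
          exacts [occupancy_le_sub _ hd, hs n]
  rw [← Finset.sum_Ico_add_eq_sum_Icc hmn, Task.linearBound]
  linarith

lemma taskWork_le_linearBound_of_noCarryIn (h : IsGlobalFPSchedule ω S) (hT : 0 < (τ i).T)
    (hU : (τ i).U ≤ 1) {b d : ℝ} (hbd : b ≤ d) (hb : NoCarryIn ω S i b) :
    taskWork S i b d ≤ (τ i).linearBound (d - b) := by
  have hC := ω.C_nonneg i
  have hfin : {j | b ≤ ω.arrival i j ∧ ω.arrival i j ≤ d}.Finite :=
    (ω.finite_setOf_arrival_le hT d).subset fun _ hj => hj.2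
  obtain ⟨J, hJ⟩ := hfin.exists_finset
  have hmem (j) (x) (hx : x ∈ Set.Ico b d) (hxj : x ∈ executionSet S i j) : j ∈ J :=
    (hJ j).2 ⟨h.le_arrival_of_noCarryIn hb hx.1 hxj, (h.pending_of_mem hxj).1.trans hx.2.le⟩
  rcases J.eq_empty_or_nonempty with rfl | hne
  · exact (h.taskWork_le_sum_service hmem).trans
      (Task.linearBound_nonneg hC hT hU (sub_nonneg.2 hbd))
  · have hfirst := (hJ _).1 (J.min'_mem hne)
    have hlast := (hJ _).1 (J.max'_mem hne)
    calc taskWork S i b d ≤ ∑ j ∈ Finset.Icc (J.min' hne) (J.max' hne), service ω S i j d :=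
          h.taskWork_le_sum_service fun j x hx hxj =>
            Finset.mem_Icc.2 ⟨J.min'_le j (hmem j x hx hxj), J.le_max' j (hmem j x hx hxj)⟩
      _ ≤ (τ i).linearBound (d - ω.arrival i (J.min' hne)) :=
          h.sum_Icc_service_le_linearBound hT hU (J.min'_le_max' hne) hlast.2
      _ ≤ (τ i).linearBound (d - b) :=
          Task.linearBound_mono hC hT (sub_le_sub_left hfirst.1 d)

lemma exists_busy_interval_of_deadline_miss (h : IsGlobalFPSchedule ω S) (hT : 0 < (τ k).T)
    (hD : 0 < (τ k).D) {j : ℕ}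
    (hmiss : service ω S k j (ω.arrival k j + (τ k).D) < ω.exec k j) :
    ∃ (a d : ℝ) (ℓ : ℕ), 1 ≤ ℓ ∧ ((ℓ : ℝ) - 1) * (τ k).T + (τ k).D ≤ d - a ∧
      (∀ x ∈ Set.Ico a d, Active ω S k x) ∧ taskWork S k a d < ℓ * (τ k).C := by
  set d := ω.arrival k j + (τ k).D
  have hjd : ω.arrival k j < d := lt_add_of_pos_right _ hD
  have hmono := ω.arrival_strictMono hT
  obtain ⟨a, had, hact, hcarry, ha⟩ := exists_busy_start ω S hT d
  have haj : a ≤ ω.arrival k j := by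
    by_contra! hlt
    exact hmiss.not_ge ((hcarry j hlt).trans (service_mono ω S k j had))
  obtain ⟨m, rfl⟩ := ha.resolve_left (haj.trans_lt hjd).ne
  have hmj : m ≤ j := hmono.le_iff_le.1 haj
  have hexec (j') (x) (hx : x ∈ Set.Ico (ω.arrival k m) d) (hxj : x ∈ executionSet S k j') :
      j' ∈ Finset.Icc m j := by
    refine Finset.mem_Icc.2 ⟨hmono.le_iff_le.1 (h.le_arrival_of_noCarryIn hcarry hx.1 hxj), ?_⟩
    by_contra! hlt
    exact h.not_pending_of_mem hxj hlt ⟨(hmono hlt).le.trans (h.pending_of_mem hxj).1,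
      (service_mono ω S k j hx.2.le).trans_lt hmiss⟩
  refine ⟨ω.arrival k m, d, j + 1 - m, by omega, ?_, hact, ?_⟩
  · rw [Nat.cast_sub (by omega)]
    push_cast
    linarith [ω.sub_mul_period_le k hmj]
  · calc taskWork S k (ω.arrival k m) d ≤ ∑ j' ∈ Finset.Icc m j, service ω S k j' d :=
          h.taskWork_le_sum_service hexec
      _ < ∑ _j' ∈ Finset.Icc m j, (τ k).C :=
          Finset.sum_lt_sum (fun j' _ => (h.service_le_exec k j' d).trans (ω.exec_le k j'))
            ⟨j, Finset.right_mem_Icc.2 hmj, hmiss.trans_le (ω.exec_le k j)⟩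
      _ = (j + 1 - m : ℕ) * (τ k).C := by simp

lemma exists_overloaded_window_of_deadline_miss (h : IsGlobalFPSchedule ω S) (hM : 1 ≤ M)
    (hT : 0 < (τ k).T) (hD : 0 < (τ k).D) {u : ℝ} (hu : (τ k).density ≤ u) {j : ℕ}
    (hmiss : service ω S k j (ω.arrival k j + (τ k).D) < ω.exec k j) :
    ∃ (a d : ℝ) (ℓ : ℕ), 1 ≤ ℓ ∧ ((ℓ : ℝ) - 1) * (τ k).T + (τ k).D ≤ d - a ∧
      0 < ℓ * (τ k).C + excessWork S k (M - (M - 1) * u) a d := by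
  obtain ⟨a, d, ℓ, hℓ, hlen, hact, hwork⟩ := h.exists_busy_interval_of_deadline_miss hT hD hmiss
  refine ⟨a, d, ℓ, hℓ, hlen, ?_⟩
  have hℓ' : (1 : ℝ) ≤ ℓ := by exact_mod_cast hℓ
  have hM' : (0 : ℝ) ≤ (M : ℝ) - 1 := sub_nonneg.2 (by exact_mod_cast hM)
  have hlen0 : 0 ≤ ((ℓ : ℝ) - 1) * (τ k).T + (τ k).D :=
    add_nonneg (mul_nonneg (sub_nonneg.2 hℓ') hT.le) hD.le
  have hrate : taskWork S k a d ≤ u * (d - a) :=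
    calc taskWork S k a d ≤ ℓ * (τ k).C := hwork.le
      _ ≤ (τ k).density * (((ℓ : ℝ) - 1) * (τ k).T + (τ k).D) :=
          Task.mul_C_le_density_mul (ω.C_nonneg k) hD hT hℓ'
      _ ≤ u * (d - a) :=
          mul_le_mul hu hlen hlen0 ((Task.density_nonneg (ω.C_nonneg k) hD hT).trans hu)
  have hinterf := h.mul_sub_taskWork_le (sub_nonneg.1 (hlen0.trans hlen)) hact
  have := mul_le_mul_of_nonneg_left hrate hM'
  rw [excessWork]
  linarith

lemma lt_taskWork_of_excessWork_neg (h : IsGlobalFPSchedule ω S) (hM : 1 ≤ M) (hik : i < k)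
    {b t u : ℝ} (hbt : b ≤ t) (hact : ∀ x ∈ Set.Ico b t, Active ω S i x)
    (hexc : excessWork S k (M - (M - 1) * u) b t < 0) :
    u * (t - b) < taskWork S i b t := by
  have hM' : (0 : ℝ) ≤ (M : ℝ) - 1 := sub_nonneg.2 (by exact_mod_cast hM)
  refine lt_of_mul_lt_mul_left ?_ hM'
  rw [excessWork] at hexc
  linarith [h.mul_sub_taskWork_le hbt hact, taskWork_add_higherPriorityWork_le S hik b t]

lemma exists_window_taskWork_le_linearBound (h : IsGlobalFPSchedule ω S) (hM : 1 ≤ M)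
    (hT : ∀ i < k, 0 < (τ i).T) (hU : ∀ i < k, (τ i).U ≤ 1) {u : ℝ}
    (hu : ∀ i < k, (τ i).U ≤ u) {a d : ℝ} (had : a ≤ d) :
    ∃ t ≤ a, excessWork S k (M - (M - 1) * u) a d ≤ excessWork S k (M - (M - 1) * u) t d ∧
      ∀ i < k, taskWork S i t d ≤ (τ i).linearBound (d - t) := by
  obtain ⟨t, hta, hmax, hbusy⟩ := exists_window_max_excessWork ω S hT (M - (M - 1) * u) had
  refine ⟨t, hta, hmax, fun i hik => ?_⟩
  obtain ⟨b, hbt, hcarry, hact, hneg⟩ := hbusy i hik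
  have hbound := h.taskWork_le_linearBound_of_noCarryIn (hT i hik) (hU i hik)
    (hbt.trans (hta.trans had)) hcarry
  rcases hbt.eq_or_lt with rfl | hlt
  · exact hbound
  · have hrate : (τ i).U * (t - b) ≤ taskWork S i b t :=
      (mul_le_mul_of_nonneg_right (hu i hik) (sub_nonneg.2 hbt)).trans
        (h.lt_taskWork_of_excessWork_neg hM hik hbt hact (hneg hlt)).le
    rw [Task.linearBound] at hbound ⊢
    linarith [taskWork_add S i hbt (hta.trans had)]

end IsGlobalFPSchedule

end

end GlobalFP

open GlobalFP in
theorem theorem4p5_general {M N : ℕ} (hM : 1 ≤ M) {τ : Fin N → Task} {k : Fin N}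
    (hT : ∀ i ≤ k, 0 < (τ i).T) (hU : ∀ i < k, (τ i).U ≤ 1) (hD : 0 < (τ k).D)
    (htest : ∀ ℓ : ℕ, 1 ≤ ℓ →
      (ℓ : ℝ) * (τ k).C / (((ℓ : ℝ) - 1) * (τ k).T + (τ k).D)
        + ∑ i ∈ Finset.Iio k,
            (((τ i).C - (τ i).C * (τ i).U) / (((ℓ : ℝ) - 1) * (τ k).T + (τ k).D) + (τ i).U)
        ≤ (M : ℝ) - ((M : ℝ) - 1) * Umax τ k) :
    Schedulable M τ k := by
  intro ω S h j
  by_contra! hmiss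
  obtain ⟨a, d, ℓ, hℓ, hlen, hover⟩ := h.exists_overloaded_window_of_deadline_miss hM
    (hT k le_rfl) hD (density_le_Umax τ k) hmiss
  have hℓ' : (0 : ℝ) ≤ (ℓ : ℝ) - 1 := sub_nonneg.2 (by exact_mod_cast hℓ)
  have hlen_pos : 0 < ((ℓ : ℝ) - 1) * (τ k).T + (τ k).D :=
    add_pos_of_nonneg_of_pos (mul_nonneg hℓ' (hT k le_rfl).le) hD
  obtain ⟨t, hta, hexc, hwork⟩ := h.exists_window_taskWork_le_linearBound hM
    (fun i hi => hT i hi.le) hU (fun i hi => U_le_Umax hi)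
    (sub_nonneg.1 (hlen_pos.le.trans hlen))
  have hload : higherPriorityWork S k t d ≤ ∑ i ∈ Finset.Iio k, (τ i).linearBound (d - t) :=
    Finset.sum_le_sum fun i hi => hwork i (Finset.mem_Iio.1 hi)
  have hcap := add_sum_linearBound_le_mul hlen_pos (hlen.trans (sub_le_sub_left hta d))
    (mul_nonneg (Nat.cast_nonneg ℓ) (ω.C_nonneg k))
    (fun i hi => Task.C_sub_C_mul_U_nonneg (ω.C_nonneg i) (hU i (Finset.mem_Iio.1 hi)))
    (htest ℓ hℓ)
  unfold excessWork at hover hexc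
  linarith

theorem theorem4p5 (M N : ℕ) (hM : 2 ≤ M) (τ : Fin N → GlobalFP.Task)
    (hτ : ∀ i, (τ i).Admissible) (k : Fin N)
    (htest : ∀ ℓ : ℕ, 1 ≤ ℓ →
      (ℓ : ℝ) * (τ k).C / (((ℓ : ℝ) - 1) * (τ k).T + (τ k).D)
        + ∑ i ∈ Finset.Iio k,
            (((τ i).C - (τ i).C * (τ i).U) / (((ℓ : ℝ) - 1) * (τ k).T + (τ k).D) + (τ i).U)
        ≤ (M : ℝ) - ((M : ℝ) - 1) * GlobalFP.Umax τ k) :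
    GlobalFP.Schedulable M τ k :=
  theorem4p5_general (one_le_two.trans hM) (fun i _ => (hτ i).T_pos) (fun i _ => (hτ i).U_le_one)
    (hτ k).D_pos htest
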